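/- **Setting.** All systems are qubits. For $\gamma\in(0,1)$ let $\mathcal N_\gamma(\rho)=(1-\gamma)\rho+\gamma\,\mathrm{tr}(\rho)\,I/2$ be the qubit depolarizing channel. For $U\in SU(2)$ let $\mathcal U(\rho)=U\rho U^\dagger$, let $|U\rangle\!\rangle=\sum_i|i\rangle\otimes U|i\rangle$, and let $J^{\mathcal N_\gamma\circ\mathcal U}$ be the Choi operator of $\mathcal N_\gamma\circ\mathcal U$. For a system $X$ of dimension $d_X$ write ${}_XC:=\frac{I_X}{d_X}\otimes\mathrm{tr}_X[C]$. A *2-slot strategy with indefinite causal order* (ICO strategy) is an operator $C$ on $P\otimes I_1\otimes O_1\otimes I_2\otimes O_2\otimes F$ such that $$C\ge 0,\quad {}_{I_2O_2F}C={}_{O_1I_2O_2F}C,\quad {}_{I_1O_1F}C={}_{I_1O_1O_2F}C,\quad {}_FC+{}_{O_1O_2F}C={}_{O_1F}C+{}_{O_2F}C,$$ $${}_{I_1O_1I_2O_2F}C={}_{PI_1O_1I_2O_2F}C,\qquad \mathrm{tr}[C]=8 .$$ Inserting the noisy gate in both slots gives the map $\mathcal E_U$ from $P$ to $F$ with Choi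 operator $J^{\mathcal E_U}=C*(J^{\mathcal N_\gamma\circ\mathcal U})^{\otimes 2}$, where $*$ is the link product (contraction over $I_1O_1I_2O_2$). The channel fidelity to $U$ is $F(J,U)=\mathrm{tr}\big[J\,|U\rangle\!\rangle\langle\!\langle U|\big]/4$. The strategy $C$ is a *universal unitary purification protocol* for $\mathcal N_\gamma$ if $F(J^{\mathcal E_U},U)\ge F(J^{\mathcal N_\gamma\circ\mathcal U},U)$ for all $U\in SU(2)$, and it is *nontrivial* if the inequality is strict for at least one $U\in SU(2)$. The *trivial strategy* sends the input through the first slot and out unchanged, feeds the maximally mixed state into the second slot, and discards the output of that slot. **Theorem.** Let $\gamma\in(0,1)$. 1. No 2-slot ICO strategy is a nontrivial universal unitary purification protocol for $\mathcal N_\gamma$. 2. The maximum over all 2-slot ICO strategies of the average fidelity is attained and $$\max_{C\ \mathrm{ICO}}\ \int_{SU(2)}F(J^{\mathcal E_U},U)\,\mathrm dU \;=\; 1-\tfrac34\gamma ,$$ where $\mathrm dU$ is the Haar probability measure on $SU(2)$. 3. The trivial strategy is a 2-slot ICO strategy whose channel fidelity equals $1-\frac34\gamma$ for every $U\in SU(2)$,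 the same as the channel fidelity of the bare noisy gate $\mathcal N_\gamma\circ\mathcal U$. -/

import Mathlib

open scoped Kronecker ComplexOrder

noncomputable section

namespace UnitaryPurification

/-! ## The group `SU(2)` and its Haar probability measure -/

/-- The special unitary group `SU(2)`, with the topology induced from `2 × 2` complex matrices. -/
abbrev SU2 : Type := Matrix.specialUnitaryGroup (Fin 2) ℂ

instance instIsTopologicalGroupSU2 : IsTopologicalGroup SU2 where
  continuous_mul := continuous_mul
  continuous_inv := by
    refine continuous_induced_rng.mpr ?_
    exact (continuous_subtype_val (p := fun A : Matrix (Fin 2) (Fin 2) ℂ =>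
      A ∈ Matrix.specialUnitaryGroup (Fin 2) ℂ)).star

instance instCompactSpaceSU2 : CompactSpace SU2 := by
  have hcl : IsClosed {A : Matrix (Fin 2) (Fin 2) ℂ |
      A ∈ Matrix.specialUnitaryGroup (Fin 2) ℂ} := by
    have h : {A : Matrix (Fin 2) (Fin 2) ℂ | A ∈ Matrix.specialUnitaryGroup (Fin 2) ℂ} =
        {A | A * star A = 1} ∩ {A | A.det = 1} := by
      ext A
      simp [Matrix.mem_specialUnitaryGroup_iff, Matrix.mem_unitaryGroup_iff]
    rw [h]
    exact (isClosed_eq (by fun_prop) continuous_const).inter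
      (isClosed_eq (by fun_prop) continuous_const)
  have hK : IsCompact (Set.pi Set.univ fun _ : Fin 2 =>
      Set.pi Set.univ fun _ : Fin 2 => Metric.closedBall (0 : ℂ) 1) :=
    isCompact_univ_pi fun _ => isCompact_univ_pi fun _ => isCompact_closedBall 0 1
  refine isCompact_iff_compactSpace.mp (hK.of_isClosed_subset hcl ?_)
  intro A hA i _ j _
  simpa using entry_norm_bound_of_unitary (Matrix.mem_specialUnitaryGroup_iff.mp hA).1 i j

instance instMeasurableSpaceSU2 : MeasurableSpace SU2 := borel SU2

instance instBorelSpaceSU2 : BorelSpace SU2 := ⟨rfl⟩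

/-- The Haar measure on `SU(2)`, normalised to total mass one. -/
def haarSU2 : MeasureTheory.Measure SU2 := MeasureTheory.Measure.haarMeasure ⊤

/-! ## Qubit channels and Choi operators -/

/-- Operators on one qubit. -/
abbrev QubitOp : Type := Matrix (Fin 2) (Fin 2) ℂ

/-- Choi operators of qubit-to-qubit maps; an index is a pair `(input, output)`. -/
abbrev ChoiOp : Type := Matrix (Fin 2 × Fin 2) (Fin 2 × Fin 2) ℂ

/-- The unitary channel `ρ ↦ U ρ U†`. -/
def unitaryChannel (U : SU2) : QubitOp →ₗ[ℂ] QubitOp :=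
  LinearMap.mulLeft ℂ U.1 ∘ₗ LinearMap.mulRight ℂ (star U.1)

/-- The qubit depolarizing channel `ρ ↦ (1 - γ) ρ + γ tr(ρ) I / 2`. -/
def depolarizing (γ : ℝ) : QubitOp →ₗ[ℂ] QubitOp :=
  ((1 - γ : ℝ) : ℂ) • LinearMap.id +
    ((γ / 2 : ℝ) : ℂ) • (Matrix.traceLinearMap (Fin 2) ℂ ℂ).smulRight (1 : QubitOp)

/-- The Choi operator `∑ |i⟩⟨i'| ⊗ Φ(|i⟩⟨i'|)` of a linear map `Φ`. -/
def choi (Φ : QubitOp →ₗ[ℂ] QubitOp) : ChoiOp :=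
  Matrix.of fun x x' => Φ (Matrix.single x.1 x'.1 1) x.2 x'.2

/-- The Choi operator of the noisy gate `𝒩 ∘ 𝒰`. -/
def noisyChoi (N : QubitOp →ₗ[ℂ] QubitOp) (U : SU2) : ChoiOp :=
  choi (N ∘ₗ unitaryChannel U)

/-- The Choi vector `|U⟩⟩ = ∑ᵢ |i⟩ ⊗ U|i⟩`. -/
def choiVec (U : SU2) : Fin 2 × Fin 2 → ℂ := fun x => U.1 x.2 x.1

/-- The channel fidelity `tr[J |U⟩⟩⟨⟨U|] / d²` with `d = 2`. -/
def channelFidelity (J : ChoiOp) (U : SU2) : ℝ :=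
  (J * Matrix.vecMulVec (choiVec U) (star (choiVec U))).trace.re / 4

/-! ## Two-slot strategies with indefinite causal order -/

/-- The six qubit systems of a two-slot strategy: the past `P`, the input `I k` and the output
`O k` of the operation inserted in slot `k`, and the future `F`. -/
inductive Sys : Type
  | P | I1 | O1 | I2 | O2 | F
  deriving DecidableEq

instance instFintypeSys : Fintype Sys where
  elems := {Sys.P, Sys.I1, Sys.O1, Sys.I2, Sys.O2, Sys.F}
  complete := by intro s; cases s <;> decide

/-- Operators on `P ⊗ I1 ⊗ O1 ⊗ I2 ⊗ O2 ⊗ F`; a computational basis vector assigns a bit to each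
of the six systems. -/
abbrev StrategyOp : Type := Matrix (Sys → Fin 2) (Sys → Fin 2) ℂ

/-- The operation `C ↦ (I_X / d_X) ⊗ tr_X[C]` for a single system `X` of dimension `d_X = 2`. -/
def replace (X : Sys) (C : StrategyOp) : StrategyOp :=
  Matrix.of fun a b =>
    if a X = b X then
      (1 / 2 : ℂ) * ∑ x : Fin 2, C (Function.update a X x) (Function.update b X x)
    else 0

/-- The operation `C ↦ (I_X / d_X) ⊗ tr_X[C]` for a joint system `X`, given as the list of its
distinct constituents. -/
def replaceAll (X : List Sys) (C : StrategyOp) : StrategyOp :=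
  X.foldr replace C

open Sys in
/-- `C` is the Choi operator of a two-slot strategy with indefinite causal order. -/
structure IsICO (C : StrategyOp) : Prop where
  posSemidef : C.PosSemidef
  slot_one : replaceAll [I2, O2, F] C = replaceAll [O1, I2, O2, F] C
  slot_two : replaceAll [I1, O1, F] C = replaceAll [I1, O1, O2, F] C
  slots : replaceAll [F] C + replaceAll [O1, O2, F] C =
    replaceAll [O1, F] C + replaceAll [O2, F] C
  past : replaceAll [I1, O1, I2, O2, F] C = replaceAll [P, I1, O1, I2, O2, F] C
  trace : C.trace = 8

/-- The basis label of the six systems from `x = (P, F)` and `y = ((I1, O1), (I2, O2))`. -/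
def label (x : Fin 2 × Fin 2) (y : (Fin 2 × Fin 2) × (Fin 2 × Fin 2)) : Sys → Fin 2
  | .P => x.1
  | .I1 => y.1.1
  | .O1 => y.1.2
  | .I2 => y.2.1
  | .O2 => y.2.2
  | .F => x.2

/-- The link product `C * J^{⊗ 2}`: the Choi operator (from `P` to `F`) of the map obtained by
inserting in both slots of `C` the map whose Choi operator is `J`. -/
def insertBoth (C : StrategyOp) (J : ChoiOp) : ChoiOp :=
  Matrix.of fun x x' =>
    ∑ y : (Fin 2 × Fin 2) × (Fin 2 × Fin 2), ∑ y' : (Fin 2 × Fin 2) × (Fin 2 × Fin 2),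
      C (label x y) (label x' y') * (J ⊗ₖ J) y y'

/-- Channel fidelity to `U` of the map obtained from the strategy `C` and two uses of the noisy
gate `𝒩 ∘ 𝒰`. -/
def purifiedFidelity (N : QubitOp →ₗ[ℂ] QubitOp) (C : StrategyOp) (U : SU2) : ℝ :=
  channelFidelity (insertBoth C (noisyChoi N U)) U

/-- Channel fidelity to `U` of the bare noisy gate `𝒩 ∘ 𝒰`. -/
def bareFidelity (N : QubitOp →ₗ[ℂ] QubitOp) (U : SU2) : ℝ :=
  channelFidelity (noisyChoi N U) U

/-- `C` does not decrease the channel fidelity, for any `U` in `SU(2)`. -/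
def IsUniversalPurification (N : QubitOp →ₗ[ℂ] QubitOp) (C : StrategyOp) : Prop :=
  ∀ U : SU2, bareFidelity N U ≤ purifiedFidelity N C U

/-- `C` strictly increases the channel fidelity for at least one `U` in `SU(2)`. -/
def IsNontrivial (N : QubitOp →ₗ[ℂ] QubitOp) (C : StrategyOp) : Prop :=
  ∃ U : SU2, bareFidelity N U < purifiedFidelity N C U

/-- The average of the channel fidelity over Haar-random `U` in `SU(2)`. -/
def averageFidelity (N : QubitOp →ₗ[ℂ] QubitOp) (C : StrategyOp) : ℝ :=
  ∫ U : SU2, purifiedFidelity N C U ∂haarSU2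

/-- A trivial strategy: identity channels from `P` to `I1` and from `O1` to `F`; the second slot
receives the maximally mixed state and its output is discarded. -/
def trivialStrategy : StrategyOp :=
  Matrix.of fun a b =>
    (if a .P = a .I1 ∧ b .P = b .I1 then 1 else 0) *
      (if a .O1 = a .F ∧ b .O1 = b .F then 1 else 0) *
      (if a .I2 = b .I2 then 1 / 2 else 0) * (if a .O2 = b .O2 then 1 else 0)

end UnitaryPurification

end

namespace UnitaryPurification

open Matrix

/-! ## An operator inequality on three input and three output qubits -/

/-! The noisy gate has Choi operator `(1 - γ) G + (γ/2) 1` with `G = |U⟩⟩⟨⟨U|`, so the fidelity of a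
strategy splits into four terms according to which slots carry `G` and which carry white noise. With
`G` in both slots the pairing is at most 4, since the resulting channel has fidelity at most 1
(`IsICO.pairing_gateProj_le`). With noise in both slots the pairing averages exactly to 4.
Everything rests on the two mixed terms: one slot alone could contribute 8 on average, but the two
together contribute at most 10, the value `8 + 2` of the trivial strategy. The bounds 4, 10, 4
recombine to exactly `1 - 3γ/4`.

For the mixed terms, `G` is half of the identity plus a sum of Pauli products weighted by the
rotation matrix of `U` (`gateProj_eq`). The second Haar moments of that rotation turn the averages
into Pauli correlations of `(P, F)` with slot 1 and with slot 2 (`integral_pairing_fst`,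
`integral_pairing_snd`). `IsICO.sum_pairing_le` bounds the sum of these correlations through the
operator inequality `coupling_posSemidef` on the input qubits `(P, I1, I2)` and the output qubits
`(F, O1, O2)`. The inequality needs a correction term correlating the two slots with each other; the
ICO constraint makes every strategy vanish on it (`IsICO.pairing_slots`).

A nontrivial universal protocol would exceed the bound on average: its gain is continuous,
nonnegative and somewhere positive, and Haar measure charges open sets. -/

/-- Contraction of the first two of three qubits with the unnormalised maximally entangled
vector. -/
def contractFst : Matrix (Fin 2) (Fin 2 × Fin 2 × Fin 2) ℂ :=
  of fun k x => if x.1 = x.2.1 ∧ k = x.2.2 then 1 else 0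

/-- Contraction of the outer two of three qubits with the unnormalised maximally entangled
vector. -/
def contractSnd : Matrix (Fin 2) (Fin 2 × Fin 2 × Fin 2) ℂ :=
  of fun k x => if x.1 = x.2.2 ∧ k = x.2.1 then 1 else 0

/-- `∑ᵢ σᵢᵀ ⊗ σᵢ ⊗ 1`. -/
def couplingFst : Matrix (Fin 2 × Fin 2 × Fin 2) (Fin 2 × Fin 2 × Fin 2) ℂ :=
  of fun x y => (2 * ((if x.1 = x.2.1 then 1 else 0) * (if y.1 = y.2.1 then 1 else 0)) -
    (if x.1 = y.1 then 1 else 0) * (if x.2.1 = y.2.1 then 1 else 0)) *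
      (if x.2.2 = y.2.2 then 1 else 0)

/-- `∑ᵢ σᵢᵀ ⊗ 1 ⊗ σᵢ`. -/
def couplingSnd : Matrix (Fin 2 × Fin 2 × Fin 2) (Fin 2 × Fin 2 × Fin 2) ℂ :=
  of fun x y => (2 * ((if x.1 = x.2.2 then 1 else 0) * (if y.1 = y.2.2 then 1 else 0)) -
    (if x.1 = y.1 then 1 else 0) * (if x.2.2 = y.2.2 then 1 else 0)) *
      (if x.2.1 = y.2.1 then 1 else 0)

/-- `∑ᵢ 1 ⊗ σᵢ ⊗ σᵢ`. -/
def couplingTail : Matrix (Fin 2 × Fin 2 × Fin 2) (Fin 2 × Fin 2 × Fin 2) ℂ :=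
  of fun x y => (2 * ((if x.2.1 = y.2.2 then 1 else 0) * (if y.2.1 = x.2.2 then 1 else 0)) -
    (if x.2.1 = y.2.1 then 1 else 0) * (if x.2.2 = y.2.2 then 1 else 0)) *
      (if x.1 = y.1 then 1 else 0)

/-- The intertwiner from three qubits to the spin-half sector symmetric in the last two. -/
def symPart : Matrix (Fin 2) (Fin 2 × Fin 2 × Fin 2) ℂ := contractFst + contractSnd

/-- The intertwiner from three qubits to the spin-half sector antisymmetric in the last two. -/
def antiPart : Matrix (Fin 2) (Fin 2 × Fin 2 × Fin 2) ℂ := contractFst - contractSnd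

lemma contractFst_mul_self : contractFst * contractFstᴴ = (2 : ℂ) • 1 := by
  ext i j
  fin_cases i <;> fin_cases j <;>
    norm_num [contractFst, mul_apply, Fintype.sum_prod_type, Fin.sum_univ_two]

lemma contractSnd_mul_self : contractSnd * contractSndᴴ = (2 : ℂ) • 1 := by
  ext i j
  fin_cases i <;> fin_cases j <;>
    norm_num [contractSnd, mul_apply, Fintype.sum_prod_type, Fin.sum_univ_two]

lemma contractFst_mul_contractSnd : contractFst * contractSndᴴ = 1 := by
  ext i j
  fin_cases i <;> fin_cases j <;>
    norm_num [contractFst, contractSnd, mul_apply, Fintype.sum_prod_type, Fin.sum_univ_two]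

lemma contractSnd_mul_contractFst : contractSnd * contractFstᴴ = 1 := by
  have h := congrArg conjTranspose contractFst_mul_contractSnd
  simpa using h

lemma symPart_mul_self : symPart * symPartᴴ = (6 : ℂ) • 1 := by
  rw [symPart, conjTranspose_add, Matrix.add_mul, Matrix.mul_add, Matrix.mul_add,
    contractFst_mul_self, contractSnd_mul_self, contractFst_mul_contractSnd,
    contractSnd_mul_contractFst]
  module

lemma antiPart_mul_self : antiPart * antiPartᴴ = (2 : ℂ) • 1 := by
  rw [antiPart, conjTranspose_sub, Matrix.sub_mul, Matrix.mul_sub, Matrix.mul_sub,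
    contractFst_mul_self, contractSnd_mul_self, contractFst_mul_contractSnd,
    contractSnd_mul_contractFst]
  module

lemma symPart_mul_antiPart : symPart * antiPartᴴ = 0 := by
  rw [symPart, antiPart, conjTranspose_sub, Matrix.add_mul, Matrix.mul_sub, Matrix.mul_sub,
    contractFst_mul_self, contractSnd_mul_self, contractFst_mul_contractSnd,
    contractSnd_mul_contractFst]
  module

lemma antiPart_mul_symPart : antiPart * symPartᴴ = 0 := by
  have h := congrArg conjTranspose symPart_mul_antiPart
  simpa using h

/-- By Pauli completeness the coupling is `2|Φ⟩⟨Φ| - 1` with `Φ` the unnormalised maximally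
entangled vector. Writing it in `symPart` and `antiPart` exposes its action on the two copies of the
spin-half sector. -/
lemma couplingFst_eq : couplingFst =
    (1 / 2 : ℂ) • ((symPartᴴ + antiPartᴴ) * (symPart + antiPart)) - 1 := by
  have h1 : symPart + antiPart = (2 : ℂ) • contractFst := by
    rw [symPart, antiPart]; module
  have h2 : symPartᴴ + antiPartᴴ = (2 : ℂ) • contractFstᴴ := by
    rw [← conjTranspose_add, h1, conjTranspose_smul]; simp
  rw [h1, h2, Matrix.smul_mul, Matrix.mul_smul]
  ext ⟨p, i, j⟩ ⟨p', i', j'⟩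
  simp only [couplingFst, contractFst, of_apply, Matrix.sub_apply, Matrix.smul_apply, mul_apply,
    conjTranspose_apply, Fin.sum_univ_two, one_apply, Prod.mk.injEq, smul_eq_mul]
  revert p i j p' i' j'
  simp only [Fin.forall_fin_two]
  norm_num

lemma couplingSnd_eq : couplingSnd =
    (1 / 2 : ℂ) • ((symPartᴴ - antiPartᴴ) * (symPart - antiPart)) - 1 := by
  have h1 : symPart - antiPart = (2 : ℂ) • contractSnd := by
    rw [symPart, antiPart]; module
  have h2 : symPartᴴ - antiPartᴴ = (2 : ℂ) • contractSndᴴ := by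
    rw [← conjTranspose_sub, h1, conjTranspose_smul]; simp
  rw [h1, h2, Matrix.smul_mul, Matrix.mul_smul]
  ext ⟨p, i, j⟩ ⟨p', i', j'⟩
  simp only [couplingSnd, contractSnd, of_apply, Matrix.sub_apply, Matrix.smul_apply, mul_apply,
    conjTranspose_apply, Fin.sum_univ_two, one_apply, Prod.mk.injEq, smul_eq_mul]
  revert p i j p' i' j'
  simp only [Fin.forall_fin_two]
  norm_num

/-- The coupling is twice the swap of the last two qubits minus 1, and the swap differs from 1 only
on the antisymmetric sector, whose projector is `antiPartᴴ * antiPart / 2`. -/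
lemma couplingTail_eq : couplingTail = 1 - (2 : ℂ) • (antiPartᴴ * antiPart) := by
  ext ⟨p, i, j⟩ ⟨p', i', j'⟩
  simp only [couplingTail, antiPart, contractFst, contractSnd, of_apply, Matrix.sub_apply,
    Matrix.smul_apply, mul_apply,
    conjTranspose_apply, Fin.sum_univ_two, one_apply, Prod.mk.injEq, smul_eq_mul]
  revert p i j p' i' j'
  simp only [Fin.forall_fin_two]
  norm_num

/-- The projector onto the spin-three-halves sector of three qubits. -/
noncomputable def quartetProj : Matrix (Fin 2 × Fin 2 × Fin 2) (Fin 2 × Fin 2 × Fin 2) ℂ :=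
  1 - (1 / 6 : ℂ) • (symPartᴴ * symPart) - (1 / 2 : ℂ) • (antiPartᴴ * antiPart)

lemma quartetProj_posSemidef : quartetProj.PosSemidef := by
  have hH : quartetProjᴴ = quartetProj := by
    simp [quartetProj, conjTranspose_sub, conjTranspose_smul, conjTranspose_mul]
  have h1 : symPart * quartetProj = 0 := by
    rw [quartetProj, Matrix.mul_sub, Matrix.mul_sub, Matrix.mul_smul, Matrix.mul_smul,
      ← Matrix.mul_assoc, ← Matrix.mul_assoc, symPart_mul_self, symPart_mul_antiPart]
    simp [smul_smul]
  have h2 : antiPart * quartetProj = 0 := by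
    rw [quartetProj, Matrix.mul_sub, Matrix.mul_sub, Matrix.mul_smul, Matrix.mul_smul,
      ← Matrix.mul_assoc, ← Matrix.mul_assoc, antiPart_mul_self, antiPart_mul_symPart]
    simp [smul_smul]
  have h : quartetProjᴴ * quartetProj = quartetProj := by
    rw [hH]
    conv_lhs => enter [1]; rw [quartetProj]
    rw [Matrix.sub_mul, Matrix.sub_mul, Matrix.smul_mul, Matrix.smul_mul, Matrix.mul_assoc,
      Matrix.mul_assoc, h1, h2]
    simp
  rw [← h]
  exact posSemidef_conjTranspose_mul_self _

/-- The sum-of-squares decomposition behind `coupling_posSemidef`. -/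
lemma coupling_eq :
    (9 : ℂ) • (1 : Matrix ((Fin 2 × Fin 2 × Fin 2) × (Fin 2 × Fin 2 × Fin 2))
      ((Fin 2 × Fin 2 × Fin 2) × (Fin 2 × Fin 2 × Fin 2)) ℂ) + couplingTail ⊗ₖ couplingTail -
      couplingFst ⊗ₖ couplingFst - couplingSnd ⊗ₖ couplingSnd =
    (1 / 18 : ℂ) • ((symPart ⊗ₖ symPart - (9 : ℂ) • (antiPart ⊗ₖ antiPart))ᴴ *
        (symPart ⊗ₖ symPart - (9 : ℂ) • (antiPart ⊗ₖ antiPart))) +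
      (1 / 2 : ℂ) • ((symPart ⊗ₖ antiPart - antiPart ⊗ₖ symPart)ᴴ *
        (symPart ⊗ₖ antiPart - antiPart ⊗ₖ symPart)) +
      (((7 / 3 : ℂ) • (symPartᴴ * symPart) + (3 : ℂ) • (antiPartᴴ * antiPart)) ⊗ₖ quartetProj) +
      (quartetProj ⊗ₖ ((7 / 3 : ℂ) • (symPartᴴ * symPart) + (3 : ℂ) • (antiPartᴴ * antiPart))) +
      (8 : ℂ) • (quartetProj ⊗ₖ quartetProj) := by
  -- The coefficients come from normalised blocks. On the spin-half pair (sym, anti) the three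
  -- couplings are `[[2, √3], [√3, 0]]`, `[[2, -√3], [-√3, 0]]` and `diag(1, -3)`; on the quartet
  -- they are `-1, -1, 1`. The block on sym⊗sym, anti⊗anti is `[[2, -6], [-6, 18]]` and the one on
  -- sym⊗anti, anti⊗sym is `[[6, -6], [-6, 6]]`, both of rank one. Against a quartet the values are
  -- 14, 6 and 8.
  rw [couplingTail_eq, couplingFst_eq, couplingSnd_eq, quartetProj]
  simp only [conjTranspose_sub, conjTranspose_smul, conjTranspose_kronecker, Matrix.sub_mul,
    Matrix.mul_sub, Matrix.add_mul, Matrix.mul_add, Matrix.smul_mul, Matrix.mul_smul,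
    ← mul_kronecker_mul]
  rw [← one_kronecker_one]
  ext ⟨a, a'⟩ ⟨b, b'⟩
  simp only [Matrix.add_apply, Matrix.sub_apply, Matrix.smul_apply, kroneckerMap_apply,
    smul_eq_mul, star_ofNat]
  ring

/-- The tail term is indispensable: without it the block on sym⊗sym, anti⊗anti would be `[[1, -6],
[-6, 9]]`, which is indefinite. -/
lemma coupling_posSemidef :
    ((9 : ℂ) • (1 : Matrix ((Fin 2 × Fin 2 × Fin 2) × (Fin 2 × Fin 2 × Fin 2))
      ((Fin 2 × Fin 2 × Fin 2) × (Fin 2 × Fin 2 × Fin 2)) ℂ) + couplingTail ⊗ₖ couplingTail -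
      couplingFst ⊗ₖ couplingFst - couplingSnd ⊗ₖ couplingSnd).PosSemidef := by
  rw [coupling_eq]
  have hs : ((7 / 3 : ℂ) • (symPartᴴ * symPart) +
      (3 : ℂ) • (antiPartᴴ * antiPart)).PosSemidef :=
    ((posSemidef_conjTranspose_mul_self _).smul (by positivity)).add
      ((posSemidef_conjTranspose_mul_self _).smul (by positivity))
  have hq := quartetProj_posSemidef
  exact (((((posSemidef_conjTranspose_mul_self _).smul (by positivity)).add
    ((posSemidef_conjTranspose_mul_self _).smul (by positivity))).add (hs.kronecker hq)).add
    (hq.kronecker hs)).add ((hq.kronecker hq).smul (by positivity))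

/-! ## Pairing strategies with product operators -/

/-- The operator on the six systems with `G` on `(P, F)`, and with the transposes of `A` and `B` on
`(I1, O1)` and `(I2, O2)`. -/
def slotOp (G A B : ChoiOp) : StrategyOp :=
  of fun a b => G (a .P, a .F) (b .P, b .F) * A (b .I1, b .O1) (a .I1, a .O1) *
    B (b .I2, b .O2) (a .I2, a .O2)

/-- The basis labels of the six systems as tuples `((P, F), ((I1, O1), (I2, O2)))`. -/
def labelEquiv : (Fin 2 × Fin 2) × ((Fin 2 × Fin 2) × (Fin 2 × Fin 2)) ≃ (Sys → Fin 2) where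
  toFun z := label z.1 z.2
  invFun a := ((a .P, a .F), ((a .I1, a .O1), (a .I2, a .O2)))
  left_inv _ := rfl
  right_inv a := by funext s; cases s <;> rfl

lemma sum_label {M : Type*} [AddCommMonoid M] (f : (Sys → Fin 2) → M) :
    ∑ a, f a = ∑ x, ∑ y, f (label x y) := by
  rw [← labelEquiv.sum_comp, Fintype.sum_prod_type]
  rfl

lemma slotOp_eq_submatrix (G A B : ChoiOp) :
    slotOp G A B = (G ⊗ₖ (Aᵀ ⊗ₖ Bᵀ)).submatrix labelEquiv.symm labelEquiv.symm := by
  ext a b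
  exact mul_assoc _ _ _

lemma slotOp_posSemidef {G A B : ChoiOp} (hG : G.PosSemidef) (hA : A.PosSemidef)
    (hB : B.PosSemidef) : (slotOp G A B).PosSemidef := by
  rw [slotOp_eq_submatrix]
  exact (hG.kronecker (hA.transpose.kronecker hB.transpose)).submatrix _

lemma slotOp_one : slotOp 1 1 1 = 1 := by
  rw [slotOp_eq_submatrix, transpose_one, one_kronecker_one, one_kronecker_one]
  exact submatrix_one_equiv _

/-- The pairing of `C` with a product operator; the link product in `tr[(C * (A ⊗ B)) G]`. -/
def pairing (C : StrategyOp) (G A B : ChoiOp) : ℂ := (C * slotOp G A B).trace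

section multilinear

variable (C : StrategyOp) (G G' A A' B B' : ChoiOp) (c : ℂ)

lemma slotOp_add_left : slotOp (G + G') A B = slotOp G A B + slotOp G' A B := by
  ext a b; simp [slotOp]; ring

lemma slotOp_add_mid : slotOp G (A + A') B = slotOp G A B + slotOp G A' B := by
  ext a b; simp [slotOp]; ring

lemma slotOp_add_right : slotOp G A (B + B') = slotOp G A B + slotOp G A B' := by
  ext a b; simp [slotOp]; ring

lemma slotOp_smul_left : slotOp (c • G) A B = c • slotOp G A B := by
  ext a b; simp [slotOp]; ring

lemma slotOp_smul_mid : slotOp G (c • A) B = c • slotOp G A B := by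
  ext a b; simp [slotOp]; ring

lemma slotOp_smul_right : slotOp G A (c • B) = c • slotOp G A B := by
  ext a b; simp [slotOp]; ring

lemma pairing_add_left : pairing C (G + G') A B = pairing C G A B + pairing C G' A B := by
  simp [pairing, slotOp_add_left, Matrix.mul_add]

lemma pairing_add_mid : pairing C G (A + A') B = pairing C G A B + pairing C G A' B := by
  simp [pairing, slotOp_add_mid, Matrix.mul_add]

lemma pairing_add_right : pairing C G A (B + B') = pairing C G A B + pairing C G A B' := by
  simp [pairing, slotOp_add_right, Matrix.mul_add]

lemma pairing_smul_left : pairing C (c • G) A B = c * pairing C G A B := by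
  simp [pairing, slotOp_smul_left]

lemma pairing_smul_mid : pairing C G (c • A) B = c * pairing C G A B := by
  simp [pairing, slotOp_smul_mid]

lemma pairing_smul_right : pairing C G A (c • B) = c * pairing C G A B := by
  simp [pairing, slotOp_smul_right]

variable {ι : Type*} (s : Finset ι) (f : ι → ChoiOp)

lemma pairing_sum_left : pairing C (∑ i ∈ s, f i) A B = ∑ i ∈ s, pairing C (f i) A B :=
  map_sum (AddMonoidHom.mk' (fun X => pairing C X A B) fun X Y => pairing_add_left C X Y A B) f s

lemma pairing_sum_mid : pairing C G (∑ i ∈ s, f i) B = ∑ i ∈ s, pairing C G (f i) B :=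
  map_sum (AddMonoidHom.mk' (fun X => pairing C G X B) fun X Y => pairing_add_mid C G X Y B) f s

lemma pairing_sum_right : pairing C G A (∑ i ∈ s, f i) = ∑ i ∈ s, pairing C G A (f i) :=
  map_sum (AddMonoidHom.mk' (fun X => pairing C G A X) fun X Y => pairing_add_right C G A X Y) f s

end multilinear

lemma pairing_one (C : StrategyOp) : pairing C 1 1 1 = C.trace := by
  rw [pairing, slotOp_one, Matrix.mul_one]

/-- Positive semidefinite matrices pair nonnegatively. -/
lemma trace_mul_re_nonneg {n : Type*} [Fintype n] [DecidableEq n] {C M : Matrix n n ℂ}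
    (hC : C.PosSemidef) (hM : M.PosSemidef) : 0 ≤ (C * M).trace.re := by
  obtain ⟨m, v, rfl⟩ := Matrix.posSemidef_iff_eq_sum_vecMulVec.mp hM
  rw [Matrix.mul_sum, Matrix.trace_sum, Complex.re_sum]
  refine Finset.sum_nonneg fun i _ => ?_
  rw [Matrix.mul_vecMulVec, Matrix.trace_vecMulVec, dotProduct_comm]
  exact (Complex.le_def.mp (hC.dotProduct_mulVec_nonneg (v i))).1

/-- The gate projector `|U⟩⟩⟨⟨U|`. -/
def gateProj (U : SU2) : ChoiOp := vecMulVec (choiVec U) (star (choiVec U))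

/-- The transposes built into `slotOp` are those of the link product, so fidelities become traces
against `C`, to which positivity and the linear constraints apply. -/
lemma trace_insertBoth_mul (C : StrategyOp) (G J : ChoiOp) :
    (insertBoth C J * G).trace = pairing C G J J := by
  simp only [pairing, Matrix.trace, diag_apply, mul_apply, insertBoth, of_apply, slotOp, sum_label]
  refine Finset.sum_congr rfl fun x _ => ?_
  rw [Finset.sum_comm]
  refine Finset.sum_congr rfl fun x' _ => ?_
  rw [Finset.sum_mul]
  refine Finset.sum_congr rfl fun y _ => ?_
  rw [Finset.sum_mul]
  refine Finset.sum_congr rfl fun y' _ => ?_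
  simp only [kroneckerMap_apply, label]
  ring

lemma purifiedFidelity_eq (N : QubitOp →ₗ[ℂ] QubitOp) (C : StrategyOp) (U : SU2) :
    purifiedFidelity N C U =
      (pairing C (gateProj U) (noisyChoi N U) (noisyChoi N U)).re / 4 := by
  rw [← trace_insertBoth_mul]
  rfl

/-! ## Linear constraints on strategies -/

/-- On triples `(a, b, x)` with `a X = b X`, exchanging the common value at `X` with `x` is an
involution that carries one summand to the other. -/
lemma sum_update_comm {S α : Type*} [Fintype S] [DecidableEq S] [Fintype α] [DecidableEq α]
    (X : S) (C M : (S → α) → (S → α) → ℂ) :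
    ∑ z ∈ Finset.univ.filter (fun z : ((S → α) × (S → α)) × α => z.1.1 X = z.1.2 X),
        C (Function.update z.1.1 X z.2) (Function.update z.1.2 X z.2) * M z.1.2 z.1.1 =
      ∑ z ∈ Finset.univ.filter (fun z : ((S → α) × (S → α)) × α => z.1.1 X = z.1.2 X),
        C z.1.1 z.1.2 * M (Function.update z.1.2 X z.2) (Function.update z.1.1 X z.2) := by
  refine Finset.sum_nbij'
    (fun z => ((Function.update z.1.1 X z.2, Function.update z.1.2 X z.2), z.1.1 X))
    (fun z => ((Function.update z.1.1 X z.2, Function.update z.1.2 X z.2), z.1.1 X))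
    ?_ ?_ ?_ ?_ ?_
  · rintro ⟨⟨a, b⟩, x⟩ -
    exact Finset.mem_filter.mpr ⟨Finset.mem_univ _, by simp⟩
  · rintro ⟨⟨a, b⟩, x⟩ -
    exact Finset.mem_filter.mpr ⟨Finset.mem_univ _, by simp⟩
  all_goals
    rintro ⟨⟨a, b⟩, x⟩ hab
    replace hab : a X = b X := (Finset.mem_filter.mp hab).2
    have ha : Function.update b X (a X) = b := by rw [hab, Function.update_eq_self]
    simp [ha]

/-- Self-adjointness for the trace pairing moves the ICO constraints from `C` onto explicit product
operators. -/
lemma trace_replace_mul (X : Sys) (C M : StrategyOp) :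
    (replace X C * M).trace = (C * replace X M).trace := by
  have key := sum_update_comm X C M
  rw [Finset.sum_filter, Finset.sum_filter, Fintype.sum_prod_type, Fintype.sum_prod_type,
    Fintype.sum_prod_type, Fintype.sum_prod_type] at key
  have h1 : (replace X C * M).trace = (1 / 2 : ℂ) * ∑ a, ∑ b, ∑ x : Fin 2, (if a X = b X then
      C (Function.update a X x) (Function.update b X x) * M b a else 0) := by
    simp only [Matrix.trace, diag_apply, mul_apply, replace, of_apply, Finset.mul_sum]
    refine Finset.sum_congr rfl fun a _ => Finset.sum_congr rfl fun b _ => ?_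
    split_ifs
    · rw [Finset.sum_mul]
      exact Finset.sum_congr rfl fun x _ => by ring
    · simp
  have h2 : (C * replace X M).trace = (1 / 2 : ℂ) * ∑ a, ∑ b, ∑ x : Fin 2, (if a X = b X then
      C a b * M (Function.update b X x) (Function.update a X x) else 0) := by
    simp only [Matrix.trace, diag_apply, mul_apply, replace, of_apply, Finset.mul_sum]
    refine Finset.sum_congr rfl fun a _ => Finset.sum_congr rfl fun b _ => ?_
    by_cases h : a X = b X
    · rw [if_pos h.symm, Finset.mul_sum]
      exact Finset.sum_congr rfl fun x _ => by rw [if_pos h]; ring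
    · rw [if_neg (Ne.symm h)]
      simp [h]
  rw [h1, h2, key]

/-- `replace X` fixes operators that act trivially on `X`. -/
lemma replace_eq_self {X : Sys} {M : StrategyOp} (h : ∀ a b, a X ≠ b X → M a b = 0)
    (h' : ∀ a b x, a X = b X → M (Function.update a X x) (Function.update b X x) = M a b) :
    replace X M = M := by
  ext a b
  rw [replace, of_apply]
  split_ifs with hab
  · simp only [h' a b _ hab, Finset.sum_const, Finset.card_univ, Fintype.card_fin]
    simp
  · exact (h a b hab).symm

/-- `replace X` annihilates operators with vanishing partial trace over `X`. -/
lemma replace_eq_zero {X : Sys} {M : StrategyOp}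
    (h : ∀ a b, ∑ x, M (Function.update a X x) (Function.update b X x) = 0) :
    replace X M = 0 := by
  ext a b
  rw [replace, of_apply, h a b]
  simp

/-- The partial trace over the output factor of a Choi operator vanishes. -/
def OutputTraceless (A : ChoiOp) : Prop := ∀ i j, A (i, 0) (j, 0) + A (i, 1) (j, 1) = 0

section replaceSlot

variable {G A B : ChoiOp}

lemma replace_O1_eq_zero (hA : OutputTraceless A) : replace .O1 (slotOp G A B) = 0 := by
  refine replace_eq_zero fun a b => ?_
  have h := hA (b .I1) (a .I1)
  simp only [slotOp, of_apply, Fin.sum_univ_two, Function.update_apply, reduceCtorEq, if_false,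
    if_true]
  rw [← add_mul, ← mul_add, h]
  simp

lemma replace_O2_eq_zero (hB : OutputTraceless B) : replace .O2 (slotOp G A B) = 0 := by
  refine replace_eq_zero fun a b => ?_
  have h := hB (b .I2) (a .I2)
  simp only [slotOp, of_apply, Fin.sum_univ_two, Function.update_apply, reduceCtorEq, if_false,
    if_true]
  rw [← mul_add, h]
  simp

lemma replace_F_eq_self : replace .F (slotOp 1 A B) = slotOp 1 A B := by
  refine replace_eq_self (fun a b h => ?_) fun a b x h => ?_
  · simp [slotOp, one_apply, h]
  · simp [slotOp, one_apply, h]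

lemma replace_I1_eq_self : replace .I1 (slotOp G 1 B) = slotOp G 1 B := by
  refine replace_eq_self (fun a b h => ?_) fun a b x h => ?_
  · simp [slotOp, one_apply, Ne.symm h]
  · simp [slotOp, one_apply, h]

lemma replace_O1_eq_self : replace .O1 (slotOp G 1 B) = slotOp G 1 B := by
  refine replace_eq_self (fun a b h => ?_) fun a b x h => ?_
  · simp [slotOp, one_apply, Ne.symm h]
  · simp [slotOp, one_apply, h]

lemma replace_I2_eq_self : replace .I2 (slotOp G A 1) = slotOp G A 1 := by
  refine replace_eq_self (fun a b h => ?_) fun a b x h => ?_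
  · simp [slotOp, one_apply, Ne.symm h]
  · simp [slotOp, one_apply, h]

lemma replace_O2_eq_self : replace .O2 (slotOp G A 1) = slotOp G A 1 := by
  refine replace_eq_self (fun a b h => ?_) fun a b x h => ?_
  · simp [slotOp, one_apply, Ne.symm h]
  · simp [slotOp, one_apply, h]

end replaceSlot

namespace IsICO

variable {C : StrategyOp} {A B : ChoiOp}

lemma pairing_slot_one (hC : IsICO C) (hA : OutputTraceless A) : pairing C 1 A 1 = 0 := by
  have h := congrArg (fun X => (X * slotOp 1 A 1).trace) hC.slot_one
  simpa only [pairing, replaceAll, List.foldr_cons, List.foldr_nil, trace_replace_mul,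
    replace_F_eq_self,
    replace_I2_eq_self, replace_O2_eq_self, replace_O1_eq_zero hA, Matrix.mul_zero,
    Matrix.trace_zero] using h

lemma pairing_slot_two (hC : IsICO C) (hB : OutputTraceless B) : pairing C 1 1 B = 0 := by
  have h := congrArg (fun X => (X * slotOp 1 1 B).trace) hC.slot_two
  simp only [replaceAll, List.foldr_cons, List.foldr_nil, trace_replace_mul, replace_F_eq_self,
    replace_I1_eq_self, replace_O1_eq_self, replace_O2_eq_zero hB, Matrix.mul_zero,
    Matrix.trace_zero] at h
  exact h

/-- Tested on `slotOp 1 A B`, each term of the constraint that replaces `O1` or `O2` dies by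
tracelessness, and the one replacing only `F` is the pairing itself. -/
lemma pairing_slots (hC : IsICO C) (hA : OutputTraceless A) (hB : OutputTraceless B) :
    pairing C 1 A B = 0 := by
  have h := congrArg (fun X => (X * slotOp 1 A B).trace) hC.slots
  simpa only [pairing, replaceAll, List.foldr_cons, List.foldr_nil, Matrix.add_mul, Matrix.trace_add,
    trace_replace_mul, replace_F_eq_self, replace_O1_eq_zero hA, replace_O2_eq_zero hB,
    Matrix.mul_zero, Matrix.trace_zero, add_zero] using h

end IsICO

/-! ## Bloch expansion of the gate projector -/

/-- The three Pauli matrices. -/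
def pauli : Fin 3 → QubitOp :=
  ![!![0, 1; 1, 0], !![0, -Complex.I; Complex.I, 0], !![1, 0; 0, -1]]

lemma pauli_zero : pauli 0 = !![0, 1; 1, 0] := rfl

lemma pauli_one : pauli 1 = !![0, -Complex.I; Complex.I, 0] := rfl

lemma pauli_two : pauli 2 = !![1, 0; 0, -1] := rfl

lemma pauli_completeness (a b c d : Fin 2) :
    ∑ i, pauli i a b * pauli i c d =
      2 * ((if a = d then 1 else 0) * (if c = b then 1 else 0)) -
        (if a = b then 1 else 0) * (if c = d then 1 else 0) := by
  revert a b c d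
  simp only [Fin.forall_fin_two]
  norm_num [pauli_zero, pauli_one, pauli_two, Fin.sum_univ_three]

lemma trace_pauli (i : Fin 3) : (pauli i).trace = 0 := by
  fin_cases i <;> simp [pauli, Matrix.trace, Fin.sum_univ_two]

lemma trace_pauli_mul_pauli (i j : Fin 3) :
    (pauli i * pauli j).trace = if i = j then 2 else 0 := by
  fin_cases i <;> fin_cases j <;>
    norm_num [pauli, Matrix.trace, Fin.sum_univ_two]

/-- The Choi operator `σⱼᵀ ⊗ σᵢ`. -/
def pauliPair (i j : Fin 3) : ChoiOp := of fun x y => pauli i x.2 y.2 * pauli j y.1 x.1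

lemma outputTraceless_pauliPair (i j : Fin 3) : OutputTraceless (pauliPair i j) := by
  intro a b
  have h := trace_pauli i
  rw [Matrix.trace, Fin.sum_univ_two, diag_apply, diag_apply] at h
  simp only [pauliPair, of_apply]
  rw [← add_mul, h, zero_mul]

/-- The entries of the rotation of the Bloch ball induced by `U`. -/
noncomputable def bloch (U : SU2) (i j : Fin 3) : ℂ :=
  (pauli i * (U.1 * pauli j * star U.1)).trace / 2

lemma star_mul_self_SU2 (U : SU2) : star U.1 * U.1 = 1 :=
  (mem_unitaryGroup_iff'.mp (mem_specialUnitaryGroup_iff.mp U.2).1)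

lemma mul_star_self_SU2 (U : SU2) : U.1 * star U.1 = 1 :=
  (mem_unitaryGroup_iff.mp (mem_specialUnitaryGroup_iff.mp U.2).1)

lemma trace_conj_SU2 (U : SU2) (A : QubitOp) : (U.1 * A * star U.1).trace = A.trace := by
  rw [Matrix.trace_mul_comm, ← Matrix.mul_assoc, star_mul_self_SU2, Matrix.one_mul]

lemma sum_trace_pauli_mul (A : QubitOp) (b d : Fin 2) :
    ∑ i, (pauli i * A).trace * pauli i b d = 2 * A b d - A.trace * (if b = d then 1 else 0) := by
  revert b d
  simp only [Fin.forall_fin_two]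
  simp [pauli_zero, pauli_one, pauli_two, Fin.sum_univ_three, Matrix.trace, Fin.sum_univ_two,
    Matrix.mul_apply]
  refine ⟨⟨?_, ?_⟩, ?_, ?_⟩ <;> ring_nf <;> simp <;> ring

lemma sum_trace_pauli_mul_trace (A B : QubitOp) :
    ∑ i, (pauli i * A).trace * (pauli i * B).trace =
      2 * (A * B).trace - A.trace * B.trace := by
  simp [pauli_zero, pauli_one, pauli_two, Fin.sum_univ_three, Matrix.trace, Fin.sum_univ_two,
    Matrix.mul_apply]
  ring_nf
  simp
  ring

/-- Conjugation by `U` preserves the trace form on Pauli matrices, so the columns of the rotation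
are orthonormal. -/
lemma sum_bloch_mul (U : SU2) (j l : Fin 3) :
    ∑ i, bloch U i j * bloch U i l = if j = l then 1 else 0 := by
  have h := sum_trace_pauli_mul_trace (U.1 * pauli j * star U.1) (U.1 * pauli l * star U.1)
  have h2 : U.1 * pauli j * star U.1 * (U.1 * pauli l * star U.1) =
      U.1 * (pauli j * pauli l) * star U.1 := by
    calc _ = U.1 * pauli j * (star U.1 * U.1) * pauli l * star U.1 := by noncomm_ring
      _ = _ := by rw [star_mul_self_SU2]; noncomm_ring
  rw [h2, trace_conj_SU2, trace_conj_SU2, trace_conj_SU2, trace_pauli, trace_pauli,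
    trace_pauli_mul_pauli] at h
  have h3 : ∑ i, bloch U i j * bloch U i l = (1 / 4 : ℂ) *
      ∑ i, (pauli i * (U.1 * pauli j * star U.1)).trace *
        (pauli i * (U.1 * pauli l * star U.1)).trace := by
    rw [Finset.mul_sum]
    exact Finset.sum_congr rfl fun i _ => by rw [bloch, bloch]; ring
  rw [h3, h]
  split_ifs <;> norm_num

lemma gateProj_apply (U : SU2) (x y : Fin 2 × Fin 2) :
    gateProj U x y = U.1 x.2 x.1 * star (U.1 y.2 y.1) := rfl

/-- Pauli completeness is used on the output qubit to expand `U σⱼ U†`, and then on the input qubit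
to sum over `j`. -/
lemma gateProj_eq (U : SU2) :
    gateProj U = (1 / 2 : ℂ) • (1 + ∑ i, ∑ j, bloch U i j • pauliPair i j) := by
  ext ⟨a, b⟩ ⟨c, d⟩
  have h1 : ∀ j, ∑ i, bloch U i j * pauli i b d = (U.1 * pauli j * star U.1) b d := by
    intro j
    have h := sum_trace_pauli_mul (U.1 * pauli j * star U.1) b d
    rw [trace_conj_SU2, trace_pauli] at h
    calc _ = (1 / 2 : ℂ) * ∑ i, (pauli i * (U.1 * pauli j * star U.1)).trace * pauli i b d := by
          rw [Finset.mul_sum]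
          exact Finset.sum_congr rfl fun i _ => by rw [bloch]; ring
      _ = _ := by rw [h]; ring
  have h2 : ∑ j, (U.1 * pauli j * star U.1) b d * pauli j c a =
      2 * (U.1 b a * star (U.1 d c)) - (if b = d then 1 else 0) * (if c = a then 1 else 0) := by
    have hU := congrFun (congrFun (mul_star_self_SU2 U) b) d
    rw [one_apply, mul_apply] at hU
    simp only [star_apply] at hU
    have hsum : ∀ j, (U.1 * pauli j * star U.1) b d * pauli j c a =
        ∑ l, ∑ k, U.1 b k * star (U.1 d l) * (pauli j k l * pauli j c a) := by
      intro j
      rw [mul_apply, Finset.sum_mul]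
      refine Finset.sum_congr rfl fun l _ => ?_
      rw [mul_apply, Finset.sum_mul, Finset.sum_mul]
      exact Finset.sum_congr rfl fun k _ => by rw [star_apply]; ring
    simp only [hsum]
    rw [Finset.sum_comm]
    simp_rw [Finset.sum_comm (s := (Finset.univ : Finset (Fin 3))), ← Finset.mul_sum,
      pauli_completeness]
    rw [← hU]
    clear hsum
    revert a c
    simp only [Fin.forall_fin_two, Fin.sum_univ_two]
    refine ⟨⟨?_, ?_⟩, ?_, ?_⟩ <;> norm_num <;> ring
  have h3 : (∑ i, ∑ j, bloch U i j • pauliPair i j) (a, b) (c, d) =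
      ∑ j, (U.1 * pauli j * star U.1) b d * pauli j c a := by
    simp_rw [← h1, Finset.sum_mul]
    rw [Finset.sum_comm]
    simp only [Matrix.sum_apply, Matrix.smul_apply, pauliPair, of_apply, smul_eq_mul, mul_assoc]
  rw [gateProj_apply, Matrix.smul_apply, Matrix.add_apply, h3, h2, one_apply]
  by_cases hac : a = c <;> by_cases hbd : b = d <;> simp [hac, hbd, eq_comm]

/-! ### The noisy gate and its bare fidelity -/

lemma noisyChoi_depolarizing (γ : ℝ) (U : SU2) :
    noisyChoi (depolarizing γ) U =
      ((1 - γ : ℝ) : ℂ) • gateProj U + ((γ / 2 : ℝ) : ℂ) • 1 := by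
  ext ⟨a, b⟩ ⟨c, d⟩
  have h1 : unitaryChannel U (single a c 1) = U.1 * single a c 1 * star U.1 := by
    simp [unitaryChannel, Matrix.mul_assoc]
  have h2 : (U.1 * single a c (1 : ℂ) * star U.1) b d = U.1 b a * star (U.1 d c) := by
    simp [mul_apply, single_apply, Finset.sum_ite_eq, ite_and]
  have h3 : (single a c (1 : ℂ)).trace = if a = c then 1 else 0 := by
    split_ifs with h
    · subst h; simp
    · simp [h]
  simp only [noisyChoi, choi, of_apply, LinearMap.comp_apply, h1, depolarizing,
    LinearMap.add_apply, LinearMap.smul_apply, LinearMap.id_apply, LinearMap.smulRight_apply,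
    Matrix.traceLinearMap_apply, trace_conj_SU2, Matrix.add_apply, Matrix.smul_apply, h2, h3,
    gateProj_apply, one_apply, Prod.mk.injEq, smul_eq_mul]
  by_cases hac : a = c <;> by_cases hbd : b = d <;> simp [hac, hbd]

lemma gateProj_mul_self (U : SU2) : gateProj U * gateProj U = (2 : ℂ) • gateProj U := by
  have h : star (choiVec U) ⬝ᵥ choiVec U = 2 := by
    have h0 := congrArg Matrix.trace (star_mul_self_SU2 U)
    rw [Matrix.trace_one, Fintype.card_fin] at h0
    simp only [Matrix.trace, diag_apply, mul_apply, star_apply] at h0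
    rw [dotProduct, Fintype.sum_prod_type]
    simpa [choiVec] using h0
  rw [gateProj, vecMulVec_mul_vecMulVec, h]
  ext
  simp [vecMulVec_apply]
  ring

lemma gateProj_posSemidef (U : SU2) : (gateProj U).PosSemidef :=
  posSemidef_vecMulVec_self_star _

lemma two_sub_gateProj_posSemidef (U : SU2) : ((2 : ℂ) • 1 - gateProj U).PosSemidef := by
  have h : (2 : ℂ) • 1 - gateProj U =
      (1 / 2 : ℂ) • (((2 : ℂ) • 1 - gateProj U)ᴴ * ((2 : ℂ) • 1 - gateProj U)) := by
    rw [conjTranspose_sub, (gateProj_posSemidef U).1, conjTranspose_smul, conjTranspose_one,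
      Matrix.sub_mul, Matrix.mul_sub, Matrix.mul_sub, gateProj_mul_self]
    simp
    module
  rw [h]
  exact (posSemidef_conjTranspose_mul_self _).smul (by positivity)

lemma trace_noisyChoi (γ : ℝ) (U : SU2) : (noisyChoi (depolarizing γ) U).trace = 2 := by
  have h : (gateProj U).trace = 2 := by
    have h0 := congrArg Matrix.trace (star_mul_self_SU2 U)
    rw [Matrix.trace_one, Fintype.card_fin] at h0
    simp only [Matrix.trace, diag_apply, mul_apply, star_apply] at h0
    rw [Matrix.trace, Fintype.sum_prod_type]
    simpa [gateProj_apply, mul_comm] using h0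
  rw [noisyChoi_depolarizing, Matrix.trace_add, Matrix.trace_smul, Matrix.trace_smul, h,
    Matrix.trace_one]
  simp
  ring

lemma bareFidelity_depolarizing (γ : ℝ) (U : SU2) :
    bareFidelity (depolarizing γ) U = 1 - 3 / 4 * γ := by
  have h : (gateProj U).trace = 2 := by
    have h := trace_noisyChoi 0 U
    simpa [noisyChoi_depolarizing] using h
  change (noisyChoi (depolarizing γ) U * gateProj U).trace.re / 4 = _
  rw [noisyChoi_depolarizing, Matrix.add_mul, Matrix.smul_mul, Matrix.smul_mul, gateProj_mul_self,
    Matrix.one_mul, Matrix.trace_add, Matrix.trace_smul, Matrix.trace_smul, Matrix.trace_smul, h]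
  simp [← Complex.ofReal_ofNat]
  ring

/-! ## Bounds on the pairings of a strategy -/

variable {C : StrategyOp}

/-- All Pauli terms are output-traceless and drop out, leaving `(1/2)² · tr C = 2`. -/
lemma IsICO.pairing_one_gateProj (hC : IsICO C) (U : SU2) :
    pairing C 1 (gateProj U) (gateProj U) = 2 := by
  rw [gateProj_eq]
  have h1 := fun i j => hC.pairing_slot_one (outputTraceless_pauliPair i j)
  have h2 := fun i j => hC.pairing_slot_two (outputTraceless_pauliPair i j)
  have h3 := fun i j k l => hC.pairing_slots (outputTraceless_pauliPair i j)
    (outputTraceless_pauliPair k l)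
  simp only [pairing_smul_mid, pairing_smul_right, pairing_add_mid, pairing_add_right,
    pairing_sum_mid, pairing_sum_right, h1, h2, h3, pairing_one, hC.trace, mul_zero,
    Finset.sum_const_zero, add_zero]
  norm_num

/-- Since `gateProj U ≤ 2`, the pairing is at most twice the one with the identity on `(P, F)`. -/
lemma IsICO.pairing_gateProj_le (hC : IsICO C) (U : SU2) :
    (pairing C (gateProj U) (gateProj U) (gateProj U)).re ≤ 4 := by
  have h := trace_mul_re_nonneg hC.posSemidef
    (slotOp_posSemidef (two_sub_gateProj_posSemidef U) (gateProj_posSemidef U)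
      (gateProj_posSemidef U))
  change 0 ≤ (pairing C _ _ _).re at h
  rw [sub_eq_add_neg, ← neg_one_smul ℂ, pairing_add_left, pairing_smul_left, pairing_smul_left,
    hC.pairing_one_gateProj] at h
  norm_num at h
  linarith

open MeasureTheory

/-- The six systems regrouped as `((P, I1, I2), (F, O1, O2))`. -/
def inOut (a : Sys → Fin 2) : (Fin 2 × Fin 2 × Fin 2) × (Fin 2 × Fin 2 × Fin 2) :=
  ((a .P, a .I1, a .I2), (a .F, a .O1, a .O2))

lemma inOut_injective : Function.Injective inOut := by
  intro a b h
  simp only [inOut, Prod.mk.injEq] at h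
  obtain ⟨⟨h1, h2, h3⟩, h4, h5, h6⟩ := h
  funext s
  cases s <;> assumption

lemma one_choiOp_apply (x y : Fin 2 × Fin 2) :
    (1 : ChoiOp) x y = (if x.1 = y.1 then 1 else 0) * (if x.2 = y.2 then 1 else 0) := by
  rw [one_apply]
  by_cases h1 : x.1 = y.1 <;> by_cases h2 : x.2 = y.2 <;> simp [Prod.ext_iff, h1, h2]

/-- The index `i` touches only output qubits and `j` only input qubits, so the double sum factors
and each factor is evaluated by Pauli completeness. -/
lemma sum_slotOp_fst (a b : Sys → Fin 2) :
    ∑ i, ∑ j, slotOp (pauliPair i j) (pauliPair i j) 1 a b =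
      couplingFst (inOut a).1 (inOut b).1 * couplingFst (inOut a).2 (inOut b).2 := by
  have h : ∀ i j, slotOp (pauliPair i j) (pauliPair i j) 1 a b =
      (pauli i (a .F) (b .F) * pauli i (b .O1) (a .O1)) *
        (pauli j (b .P) (a .P) * pauli j (a .I1) (b .I1)) *
        (1 : ChoiOp) (b .I2, b .O2) (a .I2, a .O2) := by
    intro i j
    simp only [slotOp, pauliPair, of_apply]
    ring
  simp_rw [h, ← Finset.sum_mul, ← Finset.sum_mul_sum, pauli_completeness, one_choiOp_apply]
  simp only [couplingFst, of_apply, inOut, eq_comm (a := b _) (b := a _),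
    eq_comm (a := b .O1) (b := b .F),
    eq_comm (a := a .I1) (b := a .P)]
  ring

lemma sum_slotOp_snd (a b : Sys → Fin 2) :
    ∑ i, ∑ j, slotOp (pauliPair i j) 1 (pauliPair i j) a b =
      couplingSnd (inOut a).1 (inOut b).1 * couplingSnd (inOut a).2 (inOut b).2 := by
  have h : ∀ i j, slotOp (pauliPair i j) 1 (pauliPair i j) a b =
      (pauli i (a .F) (b .F) * pauli i (b .O2) (a .O2)) *
        (pauli j (b .P) (a .P) * pauli j (a .I2) (b .I2)) *
        (1 : ChoiOp) (b .I1, b .O1) (a .I1, a .O1) := by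
    intro i j
    simp only [slotOp, pauliPair, of_apply]
    ring
  simp_rw [h, ← Finset.sum_mul, ← Finset.sum_mul_sum, pauli_completeness, one_choiOp_apply]
  simp only [couplingSnd, of_apply, inOut, eq_comm (a := b _) (b := a _),
    eq_comm (a := b .O2) (b := b .F),
    eq_comm (a := a .I2) (b := a .P)]
  ring

lemma sum_slotOp_tail (a b : Sys → Fin 2) :
    ∑ i, ∑ j, slotOp 1 (pauliPair i j) (pauliPair i j) a b =
      couplingTail (inOut a).1 (inOut b).1 * couplingTail (inOut a).2 (inOut b).2 := by
  have h : ∀ i j, slotOp 1 (pauliPair i j) (pauliPair i j) a b =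
      (pauli i (b .O1) (a .O1) * pauli i (b .O2) (a .O2)) *
        (pauli j (a .I1) (b .I1) * pauli j (a .I2) (b .I2)) *
        (1 : ChoiOp) (a .P, a .F) (b .P, b .F) := by
    intro i j
    simp only [slotOp, pauliPair, of_apply]
    ring
  simp_rw [h, ← Finset.sum_mul, ← Finset.sum_mul_sum, pauli_completeness, one_choiOp_apply]
  simp only [couplingTail, of_apply, inOut, eq_comm (a := b _) (b := a _)]
  ring

lemma slot_coupling_posSemidef :
    ((9 : ℂ) • (1 : StrategyOp) + ∑ i, ∑ j, slotOp 1 (pauliPair i j) (pauliPair i j) -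
      ∑ i, ∑ j, slotOp (pauliPair i j) (pauliPair i j) 1 -
      ∑ i, ∑ j, slotOp (pauliPair i j) 1 (pauliPair i j)).PosSemidef := by
  convert coupling_posSemidef.submatrix inOut using 1
  ext a b
  simp only [Matrix.add_apply, Matrix.sub_apply, Matrix.sum_apply, sum_slotOp_fst, sum_slotOp_snd,
    sum_slotOp_tail, submatrix_apply, kroneckerMap_apply, Matrix.smul_apply, one_apply,
    inOut_injective.eq_iff]

/-- Gate correlations of the future with the two slots exclude each other. -/
lemma IsICO.sum_pairing_le (hC : IsICO C) :
    (∑ i, ∑ j, pairing C (pauliPair i j) (pauliPair i j) 1 +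
      ∑ i, ∑ j, pairing C (pauliPair i j) 1 (pauliPair i j)).re ≤ 72 := by
  have h := trace_mul_re_nonneg hC.posSemidef slot_coupling_posSemidef
  simp only [Matrix.mul_add, Matrix.mul_sub, Matrix.mul_sum, Matrix.mul_smul, Matrix.mul_one,
    Matrix.trace_add, Matrix.trace_sub, Matrix.trace_sum, Matrix.trace_smul, hC.trace] at h
  change 0 ≤ ((9 : ℂ) • (8 : ℂ) +
    ∑ i, ∑ j, pairing C 1 (pauliPair i j) (pauliPair i j) -
    ∑ i, ∑ j, pairing C (pauliPair i j) (pauliPair i j) 1 -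
    ∑ i, ∑ j, pairing C (pauliPair i j) 1 (pauliPair i j)).re at h
  -- The correction term vanishes on ICO strategies; what remains of the positivity is `9 · tr C =
  -- 72` minus the two correlations.
  have h0 := fun i j => hC.pairing_slots (outputTraceless_pauliPair i j)
    (outputTraceless_pauliPair i j)
  simp only [h0, Finset.sum_const_zero, add_zero, Complex.sub_re, smul_eq_mul] at h
  norm_num at h
  simp only [Complex.add_re, Complex.re_sum]
  linarith

/-! ## Haar moments of the Bloch rotation -/

instance : haarSU2.IsHaarMeasure := by unfold haarSU2; infer_instance

instance : IsProbabilityMeasure haarSU2 :=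
  ⟨by simpa [haarSU2] using
    Measure.haarMeasure_self (K₀ := (⊤ : TopologicalSpace.PositiveCompacts SU2))⟩

lemma continuous_coe_SU2 : Continuous fun U : SU2 => U.1 := continuous_subtype_val

lemma continuous_bloch (i j : Fin 3) : Continuous fun U => bloch U i j := by
  unfold bloch
  have h := continuous_coe_SU2
  have h' := h.star
  exact ((continuous_const.matrix_mul
    ((h.matrix_mul continuous_const).matrix_mul h')).matrix_trace).div_const 2

lemma integrable_of_continuous {f : SU2 → ℂ} (hf : Continuous f) : Integrable f haarSU2 :=
  hf.integrable_of_hasCompactSupport (HasCompactSupport.of_compactSpace f)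

lemma bloch_mul (V U : SU2) (i j : Fin 3) :
    bloch (V * U) i j =
      (star V.1 * pauli i * V.1 * (U.1 * pauli j * star U.1)).trace / 2 := by
  rw [bloch]
  congr 1
  rw [Submonoid.coe_mul, star_mul]
  calc _ = ((pauli i * V.1 * (U.1 * pauli j * star U.1)) * star V.1).trace := by
        congr 1; noncomm_ring
    _ = _ := by rw [Matrix.trace_mul_comm]; congr 1; noncomm_ring

/-- The rotation by `π` about the `k`-th axis. -/
def halfTurn (k : Fin 3) : SU2 :=
  ⟨Complex.I • pauli k, by
    rw [mem_specialUnitaryGroup_iff, mem_unitaryGroup_iff]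
    constructor
    · ext i j
      fin_cases k <;> fin_cases i <;> fin_cases j <;>
        simp [pauli, mul_apply, Fin.sum_univ_two, star_apply]
    · fin_cases k <;> simp [pauli, det_fin_two]⟩

lemma bloch_halfTurn_mul (k : Fin 3) (U : SU2) (i j : Fin 3) :
    bloch (halfTurn k * U) i j = (if i = k then 1 else -1) * bloch U i j := by
  have h : star (halfTurn k).1 * pauli i * (halfTurn k).1 =
      (if i = k then (1 : ℂ) else -1) • pauli i := by
    ext a b
    fin_cases k <;> fin_cases i <;> fin_cases a <;> fin_cases b <;>
      simp [halfTurn, pauli, mul_apply, Fin.sum_univ_two, star_apply]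
  rw [bloch_mul, h, Matrix.smul_mul, Matrix.trace_smul, bloch, smul_eq_mul, mul_div_assoc]

/-- The rotation permuting the three coordinate axes cyclically. -/
noncomputable def axisCycle : SU2 :=
  ⟨!![⟨1 / 2, -1 / 2⟩, ⟨-1 / 2, -1 / 2⟩; ⟨1 / 2, -1 / 2⟩, ⟨1 / 2, 1 / 2⟩], by
    rw [mem_specialUnitaryGroup_iff, mem_unitaryGroup_iff]
    constructor
    · ext i j
      fin_cases i <;> fin_cases j <;>
        simp [mul_apply, Fin.sum_univ_two, star_apply, Complex.ext_iff] <;> norm_num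
    · simp [det_fin_two, Complex.ext_iff]
      norm_num⟩

lemma bloch_axisCycle_mul (U : SU2) (i j : Fin 3) :
    bloch (axisCycle * U) i j = bloch U (i + 2) j := by
  have h : star axisCycle.1 * pauli i * axisCycle.1 = pauli (i + 2) := by
    ext a b
    fin_cases i <;> fin_cases a <;> fin_cases b <;>
      simp [axisCycle, pauli, mul_apply, Fin.sum_univ_two, star_apply, Complex.ext_iff] <;>
      norm_num
  rw [bloch_mul, h, bloch]

/-- A half turn about an axis other than `i` flips the sign of row `i`. -/
lemma integral_bloch (i j : Fin 3) : ∫ U, bloch U i j ∂haarSU2 = 0 := by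
  have hi : i ≠ i + 1 := by revert i; decide
  have h := integral_mul_left_eq_self (μ := haarSU2) (fun U => bloch U i j) (halfTurn (i + 1))
  simp only [bloch_halfTurn_mul, if_neg hi, neg_one_mul] at h
  rw [integral_neg] at h
  exact self_eq_neg.mp h.symm

/-- For `i ≠ k` the half turn about axis `i` fixes row `i` and flips row `k`. For `i = k` the axis
cycle makes the three rows contribute equally, and column orthonormality fixes their sum, whence
`1/3`. -/
lemma integral_bloch_mul_bloch (i j k l : Fin 3) :
    ∫ U, bloch U i j * bloch U k l ∂haarSU2 = if i = k ∧ j = l then 1 / 3 else 0 := by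
  by_cases hik : i = k
  · subst hik
    have hcyc : ∀ i : Fin 3, ∫ U, bloch U (i + 2) j * bloch U (i + 2) l ∂haarSU2 =
        ∫ U, bloch U i j * bloch U i l ∂haarSU2 := by
      intro i
      have h := integral_mul_left_eq_self (μ := haarSU2)
        (fun U => bloch U i j * bloch U i l) axisCycle
      simpa only [bloch_axisCycle_mul] using h
    have h20 : ∫ U, bloch U 2 j * bloch U 2 l ∂haarSU2 =
        ∫ U, bloch U 0 j * bloch U 0 l ∂haarSU2 := hcyc 0
    have h12 : ∫ U, bloch U 1 j * bloch U 1 l ∂haarSU2 =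
        ∫ U, bloch U 2 j * bloch U 2 l ∂haarSU2 := hcyc 2
    have hsum : ∑ i, ∫ U, bloch U i j * bloch U i l ∂haarSU2 = if j = l then 1 else 0 := by
      rw [← integral_finsetSum Finset.univ (f := fun i U => bloch U i j * bloch U i l) fun i _ =>
        integrable_of_continuous ((continuous_bloch i j).mul (continuous_bloch i l))]
      simp [sum_bloch_mul]
    rw [Fin.sum_univ_three, h12, h20] at hsum
    have h0 : ∫ U, bloch U 0 j * bloch U 0 l ∂haarSU2 = if j = l then 1 / 3 else 0 := by
      split_ifs at hsum ⊢ <;> linear_combination hsum / 3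
    have hi : ∫ U, bloch U i j * bloch U i l ∂haarSU2 =
        ∫ U, bloch U 0 j * bloch U 0 l ∂haarSU2 := by
      fin_cases i
      exacts [rfl, h12.trans h20, h20]
    simp [hi, h0]
  · have h := integral_mul_left_eq_self (μ := haarSU2)
      (fun U => bloch U i j * bloch U k l) (halfTurn i)
    simp only [bloch_halfTurn_mul, if_neg (Ne.symm hik), if_true, one_mul, neg_one_mul, mul_neg]
      at h
    rw [integral_neg] at h
    simpa [hik] using self_eq_neg.mp h.symm

lemma integral_bloch_quadratic (a : ℂ) (p : Fin 3 → Fin 3 → ℂ)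
    (r : Fin 3 → Fin 3 → Fin 3 → Fin 3 → ℂ) :
    ∫ U, (a + ∑ i, ∑ j, bloch U i j * p i j +
      ∑ i, ∑ j, ∑ k, ∑ l, bloch U i j * bloch U k l * r i j k l) ∂haarSU2 =
      a + (1 / 3) * ∑ i, ∑ j, r i j i j := by
  have hb := continuous_bloch
  have h1 : Continuous fun U => ∑ i, ∑ j, bloch U i j * p i j := by fun_prop
  have h2 : Continuous fun U => ∑ i, ∑ j, ∑ k, ∑ l, bloch U i j * bloch U k l * r i j k l := by
    fun_prop
  rw [integral_add (integrable_of_continuous (by fun_prop)) (integrable_of_continuous h2),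
    integral_add (integrable_of_continuous (by fun_prop)) (integrable_of_continuous h1)]
  congr 1
  · have hz : ∫ U, ∑ i, ∑ j, bloch U i j * p i j ∂haarSU2 = 0 := by
      rw [integral_finsetSum _ fun i _ => integrable_of_continuous (by fun_prop)]
      refine Finset.sum_eq_zero fun i _ => ?_
      rw [integral_finsetSum _ fun j _ => integrable_of_continuous (by fun_prop)]
      refine Finset.sum_eq_zero fun j _ => ?_
      rw [integral_mul_const, integral_bloch, zero_mul]
    rw [hz]
    simp
  · rw [integral_finsetSum _ fun i _ => integrable_of_continuous (by fun_prop), Finset.mul_sum]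
    refine Finset.sum_congr rfl fun i _ => ?_
    rw [integral_finsetSum _ fun j _ => integrable_of_continuous (by fun_prop), Finset.mul_sum]
    refine Finset.sum_congr rfl fun j _ => ?_
    rw [integral_finsetSum _ fun k _ => integrable_of_continuous (by fun_prop),
      Finset.sum_eq_single i]
    · rw [integral_finsetSum _ fun l _ => integrable_of_continuous (by fun_prop),
        Finset.sum_eq_single j]
      · rw [integral_mul_const, integral_bloch_mul_bloch]
        simp
      · intro l _ hl
        rw [integral_mul_const, integral_bloch_mul_bloch]
        simp [Ne.symm hl]
      · simp
    · intro k _ hk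
      rw [integral_finsetSum _ fun l _ => integrable_of_continuous (by fun_prop)]
      refine Finset.sum_eq_zero fun l _ => ?_
      rw [integral_mul_const, integral_bloch_mul_bloch]
      simp [Ne.symm hk]
    · simp

/-! ## The average fidelity -/

lemma continuous_gateProj : Continuous gateProj := by
  refine continuous_matrix fun x y => ?_
  simp only [gateProj_apply]
  exact (continuous_coe_SU2.matrix_elem _ _).mul (continuous_coe_SU2.matrix_elem _ _).star

lemma continuous_pairing (C : StrategyOp) {X : Type*} [TopologicalSpace X] {G A B : X → ChoiOp}
    (hG : Continuous G) (hA : Continuous A) (hB : Continuous B) :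
    Continuous fun x => pairing C (G x) (A x) (B x) :=
  (continuous_const.matrix_mul (continuous_matrix fun _ _ =>
    ((hG.matrix_elem _ _).mul (hA.matrix_elem _ _)).mul (hB.matrix_elem _ _))).matrix_trace

lemma continuous_purifiedFidelity (γ : ℝ) (C : StrategyOp) :
    Continuous fun U => purifiedFidelity (depolarizing γ) C U := by
  have hJ : Continuous fun U => noisyChoi (depolarizing γ) U := by
    simp only [noisyChoi_depolarizing]
    exact (continuous_gateProj.const_smul ((1 - γ : ℝ) : ℂ)).add continuous_const
  simp only [purifiedFidelity_eq]
  exact (Complex.continuous_re.comp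
    (continuous_pairing C continuous_gateProj hJ hJ)).div_const 4

lemma integral_pairing_fst (C : StrategyOp) :
    ∫ U, pairing C (gateProj U) (gateProj U) 1 ∂haarSU2 =
      (1 / 4) * (C.trace + (1 / 3) *
        ∑ i, ∑ j, pairing C (pauliPair i j) (pauliPair i j) 1) := by
  rw [← integral_bloch_quadratic C.trace
    (fun i j => pairing C (pauliPair i j) 1 1 + pairing C 1 (pauliPair i j) 1)
    -- The order of the index pairs is harmless: only the diagonal `r i j i j` survives integration.
    (fun i j k l => pairing C (pauliPair k l) (pauliPair i j) 1), ← integral_const_mul]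
  congr 1
  funext U
  rw [gateProj_eq]
  simp only [pairing_smul_left, pairing_smul_mid, pairing_add_left, pairing_add_mid,
    pairing_sum_left, pairing_sum_mid, pairing_one, mul_add, Finset.sum_add_distrib,
    Finset.mul_sum, ← mul_assoc]
  ring_nf

lemma integral_pairing_snd (C : StrategyOp) :
    ∫ U, pairing C (gateProj U) 1 (gateProj U) ∂haarSU2 =
      (1 / 4) * (C.trace + (1 / 3) *
        ∑ i, ∑ j, pairing C (pauliPair i j) 1 (pauliPair i j)) := by
  rw [← integral_bloch_quadratic C.trace
    (fun i j => pairing C (pauliPair i j) 1 1 + pairing C 1 1 (pauliPair i j))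
    (fun i j k l => pairing C (pauliPair k l) 1 (pauliPair i j)), ← integral_const_mul]
  congr 1
  funext U
  rw [gateProj_eq]
  simp only [pairing_smul_left, pairing_smul_right, pairing_add_left, pairing_add_right,
    pairing_sum_left, pairing_sum_right, pairing_one, mul_add, Finset.sum_add_distrib,
    Finset.mul_sum, ← mul_assoc]
  ring_nf

lemma integral_pairing_none (C : StrategyOp) :
    ∫ U, pairing C (gateProj U) 1 1 ∂haarSU2 = (1 / 2) * C.trace := by
  have h := integral_bloch_quadratic C.trace (fun i j => pairing C (pauliPair i j) 1 1) 0
  simp only [Pi.zero_apply, mul_zero, Finset.sum_const_zero, add_zero] at h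
  rw [← h, ← integral_const_mul]
  congr 1
  funext U
  rw [gateProj_eq]
  simp only [pairing_smul_left, pairing_add_left, pairing_sum_left, pairing_one]

lemma IsICO.averageFidelity_le {C : StrategyOp} (hC : IsICO C) {γ : ℝ} (h0 : 0 ≤ γ)
    (h1 : γ ≤ 1) : averageFidelity (depolarizing γ) C ≤ 1 - 3 / 4 * γ := by
  have hK := continuous_gateProj
  have hc1 : Continuous fun _ : SU2 => (1 : ChoiOp) := continuous_const
  have hc := continuous_pairing C hK hK hK
  have hf := continuous_pairing C hK hK hc1
  have hs := continuous_pairing C hK hc1 hK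
  have hn := continuous_pairing C hK hc1 hc1
  have hexp : ∀ U, purifiedFidelity (depolarizing γ) C U =
      (1 - γ) ^ 2 / 4 * (pairing C (gateProj U) (gateProj U) (gateProj U)).re +
      ((1 - γ) * γ / 8 * (pairing C (gateProj U) (gateProj U) 1).re +
      ((1 - γ) * γ / 8 * (pairing C (gateProj U) 1 (gateProj U)).re +
      γ ^ 2 / 16 * (pairing C (gateProj U) 1 1).re)) := by
    intro U
    rw [purifiedFidelity_eq, noisyChoi_depolarizing]
    simp only [pairing_smul_mid, pairing_smul_right, pairing_add_mid, pairing_add_right,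
      Complex.add_re, Complex.re_ofReal_mul]
    ring
  have hre : ∀ {f : SU2 → ℂ}, Continuous f → Integrable (fun U => (f U).re) haarSU2 :=
    fun hf => (integrable_of_continuous hf).re
  have hint : ∀ {f : SU2 → ℂ}, Continuous f →
      ∫ U, (f U).re ∂haarSU2 = (∫ U, f U ∂haarSU2).re :=
    fun hf => integral_re (integrable_of_continuous hf)
  have hA : ∫ U, (pairing C (gateProj U) (gateProj U) (gateProj U)).re ∂haarSU2 ≤ 4 := by
    calc _ ≤ ∫ _ : SU2, (4 : ℝ) ∂haarSU2 :=
          integral_mono (hre hc) (integrable_const _) fun U => hC.pairing_gateProj_le U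
      _ = 4 := by simp
  have hB : ∫ U, (pairing C (gateProj U) (gateProj U) 1).re ∂haarSU2 +
      ∫ U, (pairing C (gateProj U) 1 (gateProj U)).re ∂haarSU2 ≤ 10 := by
    rw [hint hf, hint hs, integral_pairing_fst, integral_pairing_snd, hC.trace, ← Complex.add_re]
    have h := hC.sum_pairing_le
    generalize ∑ i, ∑ j, pairing C (pauliPair i j) (pauliPair i j) 1 = X at h ⊢
    generalize ∑ i, ∑ j, pairing C (pauliPair i j) 1 (pauliPair i j) = Y at h ⊢
    -- With `X + Y` of real part at most 72, this gives `4 + 72/12 = 10`.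
    have e : (1 / 4 : ℂ) * (8 + 1 / 3 * X) + 1 / 4 * (8 + 1 / 3 * Y) =
        ((4 : ℝ) : ℂ) + ((1 / 12 : ℝ) : ℂ) * (X + Y) := by
      push_cast; ring
    rw [e, Complex.add_re, Complex.re_ofReal_mul, Complex.ofReal_re]
    linarith
  have hD : ∫ U, (pairing C (gateProj U) 1 1).re ∂haarSU2 = 4 := by
    rw [hint hn, integral_pairing_none, hC.trace]
    norm_num
  have hsplit : ∀ {f g : SU2 → ℝ}, Integrable f haarSU2 → Integrable g haarSU2 →
      Integrable (fun U => f U + g U) haarSU2 := fun hf hg => hf.add hg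
  have h4 := (hre hn).const_mul (γ ^ 2 / 16)
  have h3 := (hre hs).const_mul ((1 - γ) * γ / 8)
  have h2 := (hre hf).const_mul ((1 - γ) * γ / 8)
  rw [averageFidelity]
  simp only [hexp]
  rw [integral_add ((hre hc).const_mul _) (hsplit h2 (hsplit h3 h4)),
    integral_add h2 (hsplit h3 h4), integral_add h3 h4,
    integral_const_mul, integral_const_mul, integral_const_mul, integral_const_mul, hD]
  have hA' := mul_le_mul_of_nonneg_left hA (by positivity : 0 ≤ (1 - γ) ^ 2 / 4)
  have hB' := mul_le_mul_of_nonneg_left hB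
    (div_nonneg (mul_nonneg (sub_nonneg.mpr h1) h0) (by norm_num) : 0 ≤ (1 - γ) * γ / 8)
  -- The bounds add up to `(1 - γ)² + (5/4)γ(1 - γ) + γ²/4 = 1 - 3γ/4`.
  linarith

/-- A universal purification protocol that is nontrivial beats the bare gate on average. -/
lemma lt_averageFidelity {γ : ℝ} {C : StrategyOp}
    (hC : IsUniversalPurification (depolarizing γ) C) (hn : IsNontrivial (depolarizing γ) C) :
    1 - 3 / 4 * γ < averageFidelity (depolarizing γ) C := by
  obtain ⟨V, hV⟩ := hn
  have hcont := continuous_purifiedFidelity γ C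
  have hint : Integrable (fun U => purifiedFidelity (depolarizing γ) C U) haarSU2 :=
    hcont.integrable_of_hasCompactSupport (HasCompactSupport.of_compactSpace _)
  have hpos := (hcont.sub continuous_const).integral_pos_of_hasCompactSupport_nonneg_nonzero
    (μ := haarSU2) (x := V) (HasCompactSupport.of_compactSpace _)
    (fun U => sub_nonneg.mpr (by simpa only [bareFidelity_depolarizing] using hC U))
    (sub_pos.mpr (by simpa only [bareFidelity_depolarizing] using hV)).ne'
  change 0 < ∫ U, (purifiedFidelity (depolarizing γ) C U - (1 - 3 / 4 * γ)) ∂haarSU2 at hpos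
  rw [integral_sub hint (integrable_const _)] at hpos
  simpa [averageFidelity] using hpos

/-! ## The trivial strategy -/

lemma trivialStrategy_posSemidef : trivialStrategy.PosSemidef := by
  -- Expanding the identities on `I2` and `O2` in basis states exhibits a sum of rank-one positive
  -- terms.
  have h : trivialStrategy = ∑ k : Fin 2, ∑ l : Fin 2, (1 / 2 : ℂ) •
      vecMulVec (fun a : Sys → Fin 2 =>
        if a .P = a .I1 ∧ a .O1 = a .F ∧ a .I2 = k ∧ a .O2 = l then (1 : ℂ) else 0)
      (star fun a : Sys → Fin 2 =>
        if a .P = a .I1 ∧ a .O1 = a .F ∧ a .I2 = k ∧ a .O2 = l then (1 : ℂ) else 0) := by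
    ext a b
    simp only [trivialStrategy, of_apply, Matrix.sum_apply, Matrix.smul_apply, vecMulVec_apply,
      Pi.star_apply, smul_eq_mul, apply_ite (star : ℂ → ℂ), star_one, star_zero]
    by_cases h1 : a .P = a .I1 <;> by_cases h2 : b .P = b .I1 <;>
      by_cases h3 : a .O1 = a .F <;> by_cases h4 : b .O1 = b .F <;>
      by_cases h5 : a .I2 = b .I2 <;> by_cases h6 : a .O2 = b .O2 <;>
      simp [h1, h2, h3, h4, h5, h6, ite_and, eq_comm]
  rw [h]
  exact posSemidef_sum _ fun k _ => posSemidef_sum _ fun l _ =>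
    (posSemidef_vecMulVec_self_star _).smul (by positivity)

/-- The trivial strategy after `F` is replaced by the maximally mixed state. -/
noncomputable def trivialTraceF : StrategyOp :=
  of fun a b => (if a .P = a .I1 ∧ b .P = b .I1 then 1 else 0) *
    (if a .O1 = b .O1 then 1 else 0) * (if a .F = b .F then 1 / 2 else 0) *
    (if a .I2 = b .I2 then 1 / 2 else 0) * (if a .O2 = b .O2 then 1 else 0)

/-- The trivial strategy after `I1` and `F` are replaced by maximally mixed states. -/
noncomputable def trivialTraceI1F : StrategyOp :=
  of fun a b => (if a .P = b .P then 1 else 0) * (if a .I1 = b .I1 then 1 / 2 else 0) *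
    (if a .O1 = b .O1 then 1 else 0) * (if a .F = b .F then 1 / 2 else 0) *
    (if a .I2 = b .I2 then 1 / 2 else 0) * (if a .O2 = b .O2 then 1 else 0)

lemma replace_F_trivialStrategy : replace .F trivialStrategy = trivialTraceF := by
  ext a b
  simp only [replace, trivialStrategy, trivialTraceF, of_apply, Function.update_apply, reduceCtorEq,
    if_false, if_true, ← Finset.sum_mul, ← Finset.mul_sum]
  by_cases h : a .O1 = b .O1 <;> by_cases hF : a .F = b .F <;>
    simp [h, hF, ite_and, eq_comm]

lemma replace_I1_trivialTraceF : replace .I1 trivialTraceF = trivialTraceI1F := by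
  ext a b
  simp only [replace, trivialTraceF, trivialTraceI1F, of_apply, Function.update_apply, reduceCtorEq,
    if_false, if_true, ← Finset.sum_mul]
  by_cases h : a .P = b .P <;> by_cases hF : a .I1 = b .I1 <;>
    simp [h, hF, ite_and, eq_comm]
  ring_nf

lemma replace_O1_trivialTraceF : replace .O1 trivialTraceF = trivialTraceF := by
  refine replace_eq_self (fun a b h => ?_) fun a b x h => ?_ <;> simp [trivialTraceF, h]

lemma replace_O2_trivialTraceF : replace .O2 trivialTraceF = trivialTraceF := by
  refine replace_eq_self (fun a b h => ?_) fun a b x h => ?_ <;> simp [trivialTraceF, h]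

lemma replace_I2_trivialTraceF : replace .I2 trivialTraceF = trivialTraceF := by
  refine replace_eq_self (fun a b h => ?_) fun a b x h => ?_ <;> simp [trivialTraceF, h]

lemma replace_P_trivialTraceI1F : replace .P trivialTraceI1F = trivialTraceI1F := by
  refine replace_eq_self (fun a b h => ?_) fun a b x h => ?_ <;> simp [trivialTraceI1F, h]

lemma isICO_trivialStrategy : IsICO trivialStrategy where
  posSemidef := trivialStrategy_posSemidef
  slot_one := by
    simp only [replaceAll, List.foldr_cons, List.foldr_nil, replace_F_trivialStrategy,
      replace_O2_trivialTraceF, replace_I2_trivialTraceF, replace_O1_trivialTraceF]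
  slot_two := by
    simp only [replaceAll, List.foldr_cons, List.foldr_nil, replace_F_trivialStrategy,
      replace_O2_trivialTraceF]
  slots := by
    simp only [replaceAll, List.foldr_cons, List.foldr_nil, replace_F_trivialStrategy,
      replace_O2_trivialTraceF, replace_O1_trivialTraceF]
  past := by
    simp only [replaceAll, List.foldr_cons, List.foldr_nil, replace_F_trivialStrategy,
      replace_O2_trivialTraceF, replace_O1_trivialTraceF, replace_I2_trivialTraceF,
      replace_I1_trivialTraceF, replace_P_trivialTraceI1F]
  trace := by
    rw [Matrix.trace, sum_label]
    norm_num [trivialStrategy, label, Fintype.sum_prod_type, Fin.sum_univ_two]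

/-- The first slot passes `J` through; the second, fed with the maximally mixed state and discarded,
contributes only the scalar `tr J / 2`. -/
lemma insertBoth_trivialStrategy (J : ChoiOp) :
    insertBoth trivialStrategy J = (J.trace / 2) • J := by
  ext x x'
  have h : ∀ y y' : (Fin 2 × Fin 2) × (Fin 2 × Fin 2),
      trivialStrategy (label x y) (label x' y') * (J ⊗ₖ J) y y' =
        if y.1 = x then if y'.1 = x' then
          if y.2 = y'.2 then 1 / 2 * J x x' * J y.2 y.2 else 0 else 0 else 0 := by
    rintro ⟨⟨p, q⟩, r, s⟩ ⟨⟨p', q'⟩, r', s'⟩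
    obtain ⟨a, b⟩ := x
    obtain ⟨c, d⟩ := x'
    simp only [trivialStrategy, label, of_apply, kroneckerMap_apply, Prod.mk.injEq]
    by_cases h1 : p = a <;> by_cases h2 : q = b <;> by_cases h3 : p' = c <;>
      by_cases h4 : q' = d <;> by_cases h5 : r = r' <;> by_cases h6 : s = s' <;>
      simp [h1, h2, h3, h4, h5, h6, Ne.symm, mul_assoc]
  simp only [insertBoth, of_apply, h, Matrix.smul_apply, smul_eq_mul]
  rw [Fintype.sum_prod_type, Finset.sum_eq_single x]
  · have h' : ∀ y2 : Fin 2 × Fin 2, ∑ y' : (Fin 2 × Fin 2) × (Fin 2 × Fin 2),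
        (if y'.1 = x' then if y2 = y'.2 then 1 / 2 * J x x' * J y2 y2 else 0 else 0) =
          1 / 2 * J x x' * J y2 y2 := by
      intro y2
      rw [Fintype.sum_prod_type, Finset.sum_eq_single x']
      · simp
      · intro y1' _ hy
        simp [hy]
      · simp
    simp only [if_true, h', ← Finset.mul_sum]
    rw [Matrix.trace]
    simp only [diag_apply]
    ring
  · intro y1 _ hy
    simp [hy]
  · simp

lemma purifiedFidelity_trivialStrategy (γ : ℝ) (U : SU2) :
    purifiedFidelity (depolarizing γ) trivialStrategy U = 1 - 3 / 4 * γ := by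
  rw [purifiedFidelity, insertBoth_trivialStrategy, trace_noisyChoi, div_self two_ne_zero, one_smul]
  exact bareFidelity_depolarizing γ U

end UnitaryPurification

open UnitaryPurification in
/-- No nontrivial universal two-slot purification of qubit gates under depolarizing noise. -/
theorem theorem1 (γ : ℝ) (hγ : γ ∈ Set.Ioo (0 : ℝ) 1) :
    (¬ ∃ C : StrategyOp, IsICO C ∧ IsUniversalPurification (depolarizing γ) C ∧
        IsNontrivial (depolarizing γ) C) ∧
      IsGreatest {F : ℝ | ∃ C : StrategyOp, IsICO C ∧ averageFidelity (depolarizing γ) C = F}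
        (1 - 3 / 4 * γ) ∧
      IsICO trivialStrategy ∧
      (∀ U : SU2, purifiedFidelity (depolarizing γ) trivialStrategy U = 1 - 3 / 4 * γ) ∧
      (∀ U : SU2, bareFidelity (depolarizing γ) U = 1 - 3 / 4 * γ) := by
  refine ⟨?_, ⟨⟨trivialStrategy, isICO_trivialStrategy, ?_⟩, ?_⟩, isICO_trivialStrategy,
    purifiedFidelity_trivialStrategy γ, bareFidelity_depolarizing γ⟩
  · rintro ⟨C, hC, hU, hn⟩
    exact (lt_averageFidelity hU hn).not_ge (hC.averageFidelity_le hγ.1.le hγ.2.le)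
  · simp [averageFidelity, purifiedFidelity_trivialStrategy]
  · rintro _ ⟨C, hC, rfl⟩
    exact hC.averageFidelity_le hγ.1.le hγ.2.le
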